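/- Let $k$ be a field of characteristic $0$ and let $\mathbb{G}_a=(k,+)$ be the additive group, with the polynomial functions $k\to k$ as regular functions. A $\mathbb{G}_a$-module is a finite-dimensional $k$-vector space $V$ with a rational representation $\rho:\mathbb{G}_a\to \mathrm{GL}(V)$, i.e. one all of whose matrix coefficients are regular functions. Let $k[V]$ be the ring of polynomial functions $V\to k$, on which $\mathbb{G}_a$ acts by $(t\cdot f)(v)=f(\rho(-t)v)$; let $k[V]^{\mathbb{G}_a}$ be the ring of invariants, $k[V]^{\mathbb{G}_a}_{\le d}$ the set of invariants of degree at most $d$, and for $S\subseteq k[V]$ let $S_+=\{f\in S: f(0)=0\}$. The nullcone $\mathcal N_V$ is the common zero set of $k[V]^{\mathbb{G}_a}_+$. Let $\sigma(\mathbb{G}_a,V)$ be the least $d\ge 0$ such that for every $v\in V\setminus\mathcal N_V$ there is $f\in (k[V]^{\mathbb{G}_a}_{\le d})_+$ with $f(v)\ne 0$, and let $\sigma(\mathbb{G}_a)$ be the supremum of $\sigma(\mathbb{G}_a,V)$ over all $\mathbb{G}_a$-modules $V$. Then $\sigma(\mathbb{G}_a)=2$. Moreover, for every $\mathbb{G}_a$-module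 $V$, the common zero set of $(k[V]^{\mathbb{G}_a}_{\le 2})_+$ is exactly the nullcone $\mathcal N_V$. -/

import Mathlib

namespace ZeroSeparation

universe u

section PolynomialFunctions

variable (k : Type*) [Field k] (V : Type*) [AddCommGroup V] [Module k V]

/-- A polynomial expression in linear forms on `V`, regarded as a function `V → k`. -/
noncomputable def polyToFun : MvPolynomial (Module.Dual k V) k →ₐ[k] (V → k) :=
  MvPolynomial.aeval fun φ : Module.Dual k V => (φ : V → k)

/-- The ring `k[V]` of polynomial functions `V → k`. -/
noncomputable def polyFun : Subalgebra k (V → k) :=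
  (polyToFun k V).range

/-- The polynomial functions `V → k` of degree at most `d`. -/
noncomputable def polyFunLE (d : ℕ) : Submodule k (V → k) :=
  (MvPolynomial.restrictTotalDegree (Module.Dual k V) k d).map (polyToFun k V).toLinearMap

end PolynomialFunctions

section Invariants

variable {k G V : Type*} [Field k] [Group G] [AddCommGroup V] [Module k V]

/-- The ring `k[V]^G` of polynomial functions fixed by the action `(g • f)(v) = f (g⁻¹ v)`. -/
noncomputable def invariants (ρ : Representation k G V) : Subalgebra k (V → k) where
  carrier := {f | f ∈ polyFun k V ∧ ∀ (g : G) (v : V), f (ρ g⁻¹ v) = f v}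
  mul_mem' := fun ha hb => ⟨mul_mem ha.1 hb.1, fun g v => by
    simp only [Pi.mul_apply, ha.2 g v, hb.2 g v]⟩
  add_mem' := fun ha hb => ⟨add_mem ha.1 hb.1, fun g v => by
    simp only [Pi.add_apply, ha.2 g v, hb.2 g v]⟩
  algebraMap_mem' := fun r => ⟨Subalgebra.algebraMap_mem _ r, fun _ _ => rfl⟩

/-- `k[V]^G_{≤ d}`: the invariants of degree at most `d`. -/
def invariantsLE (ρ : Representation k G V) (d : ℕ) : Set (V → k) :=
  {f | f ∈ invariants ρ ∧ f ∈ polyFunLE k V d}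

/-- `S₊`: the elements of `S` with constant term (that is, value at the origin) zero. -/
def positivePart (S : Set (V → k)) : Set (V → k) :=
  {f | f ∈ S ∧ f 0 = 0}

/-- The common zero set of a set of functions on `V`. -/
def zeroLocus (S : Set (V → k)) : Set V :=
  {v | ∀ f ∈ S, f v = 0}

/-- The nullcone `𝒱(k[V]^G₊)`. -/
def nullcone (ρ : Representation k G V) : Set V :=
  zeroLocus (positivePart (invariants ρ : Set (V → k)))

/-- `S` is a `σ`-set: a set of invariants such that each point outside the nullcone is
separated from zero by an element of `S₊`. -/
def IsSigmaSet (ρ : Representation k G V) (S : Set (V → k)) : Prop :=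
  S ⊆ (invariants ρ : Set (V → k)) ∧ ∀ v : V, v ∉ nullcone ρ → ∃ f ∈ positivePart S, f v ≠ 0

/-- `σ(G, V)`: the least `d ≥ 0` such that `k[V]^G_{≤ d}` is a `σ`-set
(it would be `⊤` if there were no such `d`). -/
noncomputable def sigmaRep (ρ : Representation k G V) : ℕ∞ :=
  ⨅ (d : ℕ) (_ : IsSigmaSet ρ (invariantsLE ρ d)), (d : ℕ∞)

/-- For a group `G` whose algebra of regular functions is `O`, a (finite-dimensional)
representation is rational if all its matrix coefficients are regular functions on `G`. -/
def IsRationalRep (O : Subalgebra k (G → k)) (ρ : Representation k G V) : Prop :=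
  ∀ (v : V) (φ : Module.Dual k V), (fun g : G => φ (ρ g v)) ∈ O

end Invariants

/-- `σ(G)`, for the group `G` with algebra of regular functions `O`: the supremum of `σ(G, V)`
over all `G`-modules `V`, i.e. all finite-dimensional rational representations. -/
noncomputable def sigma {k : Type u} [Field k] {G : Type*} [Group G]
    (O : Subalgebra k (G → k)) : ℕ∞ :=
  sSup {s : ℕ∞ | ∃ (V : Type u) (_ : AddCommGroup V) (_ : Module k V)
    (_ : FiniteDimensional k V) (ρ : Representation k G V),
    IsRationalRep O ρ ∧ s = sigmaRep ρ}

/-- The additive group `𝔾ₐ = (k, +)`, written multiplicatively. -/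
abbrev Ga (k : Type*) : Type _ := Multiplicative k

/-- The algebra of regular functions on `𝔾ₐ`: the functions `t ↦ p(t)`, `p ∈ k[T]`. -/
noncomputable def gaRegular (k : Type*) [Field k] : Subalgebra k (Ga k → k) :=
  (Polynomial.aeval (fun t : Ga k => Multiplicative.toAdd t) :
    Polynomial k →ₐ[k] (Ga k → k)).range

end ZeroSeparation

/-!
A rational representation of `𝔾ₐ` in characteristic `0` has the form `ρ(t) = exp(tN)` with `N`
nilpotent (`exists_isGenerator`, `IsGenerator.apply_eq_sum`).

*Degree two suffices.* If `φ` is a linear form with `φ ∘ N²ᵐ⁺¹ = 0`, then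
`∑ᵢ (-1)ⁱ φ(Nⁱ v) φ(N²ᵐ⁻ⁱ v)` is an invariant quadratic form (`IsGenerator.transvectant_mem`). If all
these forms vanish at `v`, then so does each `φ(Nᵐ v)`, which by duality means that `Nᵐ v` lies in
the image of `N²ᵐ⁺¹` for every `m` (`IsGenerator.pow_apply_mem_range`). Such a `v` is a sum of
vectors `Nʲ⁺¹ w` with `N²ʲ⁺² w = 0` (`induction_of_pow_apply_mem_range`); this takes the place of a
decomposition into Jordan blocks.

It remains to see that such a vector `v` is in the nullcone. The vectors `w, Nw, …, N²ʲ⁺¹ w` behave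
like the polynomials of degree at most `2j + 1` in `X`, with `𝔾ₐ` acting by translation of `X`, and
`Nʲ⁺¹ w` like `Xʲ` up to a scalar. The translate by `s⁻¹` of `Xʲ(1 - sX)ʲ⁺¹`, which tends to `Xʲ`,
is `s(sX + 1)ʲ(-X)ʲ⁺¹`, which tends to `0` (`IsGenerator.pow_apply_mem_degenerate`). An invariant
takes the same value on both curves for `s ≠ 0`, so, being polynomial, also at `s = 0`: its values at
`v` and at `0` agree (`degenerate_subset_nullcone`). Such pairs of curves can be added, so the sums
are covered as well.

*Degree one does not suffice* for the translation action on quadratic polynomials: the linear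
invariants vanish at `2X`, but the discriminant does not (`two_le_sigmaRep_quadRep`).
-/

open Polynomial

namespace ZeroSeparation

/-! ### Rational representations of `𝔾ₐ` are exponentials -/

section Generator

variable {k V : Type*} [Field k] [AddCommGroup V] [Module k V]

/-- The matrix coefficients of `ρ` are polynomials `p φ v`, and `N` is the infinitesimal generator
of `ρ`: differentiating a matrix coefficient amounts to composing the linear form with `N`. -/
structure IsGenerator (ρ : Representation k (Ga k) V) (N : Module.End k V)
    (p : Module.Dual k V → V → k[X]) : Prop where
  eval_eq : ∀ φ v t, (p φ v).eval t = φ (ρ (Multiplicative.ofAdd t) v)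
  derivative_eq : ∀ φ v, derivative (p φ v) = p (φ ∘ₗ N) v

variable {ρ : Representation k (Ga k) V} {N : Module.End k V} {p : Module.Dual k V → V → k[X]}

namespace IsGenerator

lemma iterate_derivative (h : IsGenerator ρ N p) (n : ℕ) (φ : Module.Dual k V) (v : V) :
    derivative^[n] (p φ v) = p (φ ∘ₗ N ^ n) v := by
  induction n generalizing φ with
  | zero => rfl
  | succ n ih =>
    rw [Function.iterate_succ_apply, h.derivative_eq, ih, LinearMap.comp_assoc, pow_succ']
    rfl

variable [CharZero k]

lemma coeff_eq (h : IsGenerator ρ N p) (n : ℕ) (φ : Module.Dual k V) (v : V) :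
    (p φ v).coeff n = (n.factorial : k)⁻¹ * φ ((N ^ n) v) := by
  have h1 : (derivative^[n] (p φ v)).eval 0 = φ ((N ^ n) v) := by
    rw [h.iterate_derivative, h.eval_eq, ofAdd_zero, map_one]
    rfl
  rw [← coeff_zero_eq_eval_zero, coeff_iterate_derivative, zero_add,
    Nat.descFactorial_self, nsmul_eq_mul] at h1
  rw [← h1, inv_mul_cancel_left₀ (Nat.cast_ne_zero.2 n.factorial_ne_zero)]

lemma exists_pow_apply_eq_zero [FiniteDimensional k V] (h : IsGenerator ρ N p) (v : V) :
    ∃ n, (N ^ n) v = 0 := by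
  set b := Module.finBasis k V
  refine ⟨Finset.univ.sup fun i => (p (b.coord i) v).natDegree + 1, ?_⟩
  refine b.ext_elem fun i => ?_
  have h1 : (p (b.coord i) v).coeff
      (Finset.univ.sup fun i => (p (b.coord i) v).natDegree + 1) = 0 :=
    coeff_eq_zero_of_natDegree_lt
      (Finset.le_sup (f := fun i => (p (b.coord i) v).natDegree + 1) (Finset.mem_univ i))
  rw [h.coeff_eq, mul_eq_zero] at h1
  simpa [Nat.factorial_ne_zero] using h1

/-- `ρ(t) = exp(tN)`. -/
lemma apply_eq_sum (h : IsGenerator ρ N p) {M : ℕ} {v : V} (hM : (N ^ M) v = 0) (t : k) :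
    ρ (Multiplicative.ofAdd t) v =
      ∑ n ∈ Finset.range M, ((n.factorial : k)⁻¹ * t ^ n) • (N ^ n) v := by
  rw [← sub_eq_zero, ← Module.forall_dual_apply_eq_zero_iff k]
  intro φ
  have h1 : p φ v = ∑ n ∈ Finset.range M, monomial n ((n.factorial : k)⁻¹ * φ ((N ^ n) v)) := by
    ext n
    simp only [finsetSum_coeff, coeff_monomial, h.coeff_eq, Finset.sum_ite_eq', Finset.mem_range]
    split_ifs with hn
    · rfl
    · obtain ⟨c, rfl⟩ := Nat.exists_eq_add_of_le (not_lt.1 hn)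
      rw [add_comm, pow_add, Module.End.mul_apply, hM]
      simp
  rw [map_sub, ← h.eval_eq, h1, eval_finsetSum, map_sum, sub_eq_zero]
  refine Finset.sum_congr rfl fun n _ => ?_
  rw [eval_monomial, map_smul, smul_eq_mul]
  ring

end IsGenerator

lemma exists_isGenerator [CharZero k] [FiniteDimensional k V] (hρ : IsRationalRep (gaRegular k) ρ) :
    ∃ N p, IsGenerator ρ N p := by
  have hex : ∀ (φ : Module.Dual k V) (v : V), ∃ q : k[X], ∀ t, q.eval t = φ (ρ (Multiplicative.ofAdd t) v) := by
    intro φ v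
    obtain ⟨q, hq⟩ := hρ v φ
    refine ⟨q, fun t => ?_⟩
    have h1 := congrFun hq (Multiplicative.ofAdd t)
    have h2 := aeval_algHom_apply (Pi.evalAlgHom k (fun _ : Ga k => k) (Multiplicative.ofAdd t))
      (fun t : Ga k => Multiplicative.toAdd t) q
    simp only [Pi.evalAlgHom_apply, toAdd_ofAdd, coe_aeval_eq_eval] at h2
    rw [h2]
    exact h1
  choose p hp using hex
  have hadd : ∀ φ v w, p φ (v + w) = p φ v + p φ w := fun φ v w =>
    Polynomial.funext fun t => by simp [hp]
  have hsmul : ∀ φ (c : k) v, p φ (c • v) = c • p φ v := fun φ c v =>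
    Polynomial.funext fun t => by simp [hp]
  let b := Module.finBasis k V
  let N : Module.End k V :=
    { toFun := fun v => ∑ i, (p (b.coord i) v).coeff 1 • b i
      map_add' := fun v w => by simp [hadd, add_smul, Finset.sum_add_distrib]
      map_smul' := fun c v => by simp [hsmul, mul_smul, Finset.smul_sum] }
  have hN : ∀ φ v, φ (N v) = (p φ v).coeff 1 := by
    intro φ v
    have h1 : p φ v = ∑ i, φ (b i) • p (b.coord i) v := by
      refine Polynomial.funext fun t => ?_
      simp only [hp, eval_finsetSum, eval_smul, smul_eq_mul]
      conv_lhs => rw [← b.sum_repr (ρ (Multiplicative.ofAdd t) v)]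
      simp only [map_sum, map_smul, smul_eq_mul, Module.Basis.coord_apply, mul_comm]
    rw [h1]
    simp [N, finsetSum_coeff, mul_comm]
  refine ⟨N, p, hp, fun φ v => Polynomial.funext fun t => ?_⟩
  -- The group law `ρ(s + t) = ρ(s)ρ(t)`, as an identity of polynomials in `s`.
  have h1 : p φ (ρ (Multiplicative.ofAdd t) v) = taylor t (p φ v) :=
    Polynomial.funext fun s => by
      rw [taylor_eval, hp, hp, ofAdd_add, map_mul]
      rfl
  rw [hp, LinearMap.comp_apply, hN, h1, taylor_coeff_one]

end Generator

/-! ### The quadratic invariants -/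

section Quadratic

variable {k V : Type*} [Field k] [AddCommGroup V] [Module k V]
variable {ρ : Representation k (Ga k) V} {N : Module.End k V} {p : Module.Dual k V → V → k[X]}

lemma derivative_sum_neg_one_pow_mul_iterate_derivative (P : k[X]) (m : ℕ)
    (hP : derivative^[2 * m + 1] P = 0) :
    derivative (∑ i ∈ Finset.range (2 * m + 1),
      (-1) ^ i * derivative^[i] P * derivative^[2 * m - i] P) = 0 := by
  -- The derivative telescopes to `a 0 - a (2m + 1)`, and both terms contain `P⁽²ᵐ⁺¹⁾`.
  let a : ℕ → k[X] := fun i => (-1) ^ i * derivative^[i] P * derivative^[2 * m + 1 - i] P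
  have h1 : ∀ i ∈ Finset.range (2 * m + 1),
      derivative ((-1) ^ i * derivative^[i] P * derivative^[2 * m - i] P) = a i - a (i + 1) := by
    intro i hi
    have h2 : 2 * m + 1 - i = (2 * m - i) + 1 := by
      have := Finset.mem_range.1 hi
      omega
    have h3 : derivative ((-1 : k[X]) ^ i) = 0 := by
      rw [← C_1, ← C_neg, ← C_pow, derivative_C]
    simp only [a, Nat.add_sub_add_right, h2, derivative_mul, h3, Function.iterate_succ_apply']
    ring
  rw [derivative_sum, Finset.sum_congr rfl h1, Finset.sum_range_sub']
  simp [a, hP]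

/-- The quadratic form `v ↦ ∑ᵢ (-1)ⁱ φ(Nⁱ v) φ(N²ᵐ⁻ⁱ v)`; it is `𝔾ₐ`-invariant if `φ ∘ N²ᵐ⁺¹ = 0`. -/
def transvectant (N : Module.End k V) (φ : Module.Dual k V) (m : ℕ) (v : V) : k :=
  ∑ i ∈ Finset.range (2 * m + 1), (-1) ^ i * φ ((N ^ i) v) * φ ((N ^ (2 * m - i)) v)

lemma polyFunLE_mono {d e : ℕ} (h : d ≤ e) : polyFunLE k V d ≤ polyFunLE k V e := by
  refine Submodule.map_mono fun P hP => ?_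
  rw [MvPolynomial.mem_restrictTotalDegree] at hP ⊢
  exact hP.trans h

lemma mem_polyFun_of_mem_polyFunLE {d : ℕ} {f : V → k} (hf : f ∈ polyFunLE k V d) :
    f ∈ polyFun k V := by
  obtain ⟨P, -, rfl⟩ := hf
  exact ⟨P, rfl⟩

lemma mul_mem_polyFunLE_two (φ ψ : Module.Dual k V) :
    (fun v => φ v * ψ v) ∈ polyFunLE k V 2 := by
  refine ⟨MvPolynomial.X φ * MvPolynomial.X ψ, ?_, ?_⟩
  · rw [SetLike.mem_coe, MvPolynomial.mem_restrictTotalDegree]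
    exact (MvPolynomial.totalDegree_mul _ _).trans (by simp [MvPolynomial.totalDegree_X])
  · ext v
    simp [polyToFun]

lemma transvectant_mem_polyFunLE (N : Module.End k V) (φ : Module.Dual k V) (m : ℕ) :
    transvectant N φ m ∈ polyFunLE k V 2 := by
  have : transvectant N φ m = ∑ i ∈ Finset.range (2 * m + 1),
      (-1 : k) ^ i • fun v => (φ ∘ₗ N ^ i) v * (φ ∘ₗ N ^ (2 * m - i)) v := by
    ext v
    simp [transvectant, mul_assoc]
  rw [this]
  exact Submodule.sum_mem _ fun i _ => Submodule.smul_mem _ _ (mul_mem_polyFunLE_two _ _)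

/-- Along an orbit, the quadratic form is a polynomial in `t` with zero derivative. -/
lemma IsGenerator.transvectant_apply [CharZero k] (h : IsGenerator ρ N p) {φ : Module.Dual k V} {m : ℕ}
    (hφ : φ ∘ₗ N ^ (2 * m + 1) = 0) (g : Ga k) (v : V) :
    transvectant N φ m (ρ g v) = transvectant N φ m v := by
  set Q : k[X] := ∑ i ∈ Finset.range (2 * m + 1),
      (-1) ^ i * derivative^[i] (p φ v) * derivative^[2 * m - i] (p φ v)
  have hQ : ∀ t : k, Q.eval t = transvectant N φ m (ρ (Multiplicative.ofAdd t) v) := by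
    intro t
    simp [Q, transvectant, eval_finsetSum, h.iterate_derivative, h.eval_eq]
  have h0 : derivative^[2 * m + 1] (p φ v) = 0 := by
    rw [h.iterate_derivative, hφ]
    exact Polynomial.funext fun t => by simp [h.eval_eq]
  have hC := eq_C_of_derivative_eq_zero (derivative_sum_neg_one_pow_mul_iterate_derivative _ m h0)
  have h1 := hQ (Multiplicative.toAdd g)
  have h2 := hQ 0
  rw [ofAdd_toAdd] at h1
  rw [ofAdd_zero, map_one, Module.End.one_apply] at h2
  rw [← h1, ← h2]
  change eval _ Q = eval _ Q
  rw [show Q = C _ from hC, eval_C, eval_C]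

lemma IsGenerator.transvectant_mem [CharZero k] (h : IsGenerator ρ N p) {φ : Module.Dual k V} {m : ℕ}
    (hφ : φ ∘ₗ N ^ (2 * m + 1) = 0) :
    transvectant N φ m ∈ positivePart (invariantsLE ρ 2) :=
  ⟨⟨⟨mem_polyFun_of_mem_polyFunLE (transvectant_mem_polyFunLE N φ m),
    fun g v => h.transvectant_apply hφ g⁻¹ v⟩, transvectant_mem_polyFunLE N φ m⟩,
    by simp [transvectant]⟩

/-- Induction on `m`: once the statement is known below `m`, only the middle term
`± φ(Nᵐ v)²` of the quadratic form survives at `v`. -/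
lemma IsGenerator.dual_apply_eq_zero [CharZero k] (h : IsGenerator ρ N p) {v : V}
    (hv : v ∈ zeroLocus (positivePart (invariantsLE ρ 2))) (m : ℕ) (φ : Module.Dual k V)
    (hφ : φ ∘ₗ N ^ (2 * m + 1) = 0) : φ ((N ^ m) v) = 0 := by
  induction m using Nat.strong_induction_on generalizing φ with
  | _ m ih =>
    have hi : ∀ i < m, φ ((N ^ (2 * m - i)) v) = 0 := by
      intro i hi
      have h1 : (φ ∘ₗ N ^ (2 * m - 2 * i)) ∘ₗ N ^ (2 * i + 1) = 0 := by
        rw [LinearMap.comp_assoc, ← Module.End.mul_eq_comp, ← pow_add,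
          show 2 * m - 2 * i + (2 * i + 1) = 2 * m + 1 by omega, hφ]
      have h2 := ih i hi _ h1
      rwa [LinearMap.comp_apply, ← Module.End.mul_apply, ← pow_add,
        show 2 * m - 2 * i + i = 2 * m - i by omega] at h2
    have h3 : transvectant N φ m v = 0 := hv _ (h.transvectant_mem hφ)
    rw [transvectant, Finset.sum_eq_single m] at h3
    · simpa [show 2 * m - m = m by omega] using h3
    · intro i hi' hne
      rcases lt_or_gt_of_ne hne with hlt | hgt
      · rw [hi i hlt, mul_zero]
      · have hi2 := Finset.mem_range.1 hi'
        have h4 := hi (2 * m - i) (by omega)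
        rw [show 2 * m - (2 * m - i) = i by omega] at h4
        rw [h4, mul_zero, zero_mul]
    · intro hm
      exact absurd (Finset.mem_range.2 (by omega)) hm

lemma IsGenerator.pow_apply_mem_range [CharZero k] (h : IsGenerator ρ N p) {v : V}
    (hv : v ∈ zeroLocus (positivePart (invariantsLE ρ 2))) (m : ℕ) :
    (N ^ m) v ∈ LinearMap.range (N ^ (2 * m + 1)) := by
  by_contra hn
  obtain ⟨φ, hφ, hr⟩ := Submodule.exists_le_ker_of_notMem hn
  exact hφ (h.dual_apply_eq_zero hv m φ (LinearMap.ext fun w => hr ⟨w, rfl⟩))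

/-- If `Nᵐ v` lies in the image of `N²ᵐ⁺¹` for all `m`, then `v` is a sum of vectors `Nʲ⁺¹ w`
with `N²ʲ⁺² w = 0`. In terms of an `𝔰𝔩₂`-action with raising operator `N`, these vectors have only
positive weights. -/
lemma induction_of_pow_apply_mem_range (N : Module.End k V) (S : AddSubmonoid V)
    (hS : ∀ j w, (N ^ (2 * j + 2)) w = 0 → (N ^ (j + 1)) w ∈ S) (n : ℕ) (v : V)
    (hn : (N ^ n) v = 0) (hv : ∀ m, (N ^ m) v ∈ LinearMap.range (N ^ (2 * m + 1))) : v ∈ S := by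
  induction n generalizing v with
  | zero =>
    rw [pow_zero, Module.End.one_apply] at hn
    exact hn ▸ S.zero_mem
  | succ n ih =>
    obtain ⟨w, hw⟩ := hv n
    have h1 : (N ^ n) ((N ^ (n + 1)) w) = (N ^ n) v := by
      rw [← hw, ← Module.End.mul_apply, ← pow_add]
      congr 2
      ring
    have h2 : (N ^ (2 * n + 2)) w = 0 := by
      rw [← hn, pow_succ' N n, Module.End.mul_apply, ← hw, ← Module.End.mul_apply, ← pow_succ']
    have h3 : v - (N ^ (n + 1)) w ∈ S := by
      refine ih _ (by rw [map_sub, h1, sub_self]) fun m => ?_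
      rcases lt_or_ge m n with hm | hm
      · rw [map_sub]
        refine Submodule.sub_mem _ (hv m) ⟨(N ^ (n - m)) w, ?_⟩
        rw [← Module.End.mul_apply, ← Module.End.mul_apply, ← pow_add, ← pow_add]
        congr 2
        omega
      · obtain ⟨c, rfl⟩ := Nat.exists_eq_add_of_le hm
        rw [show N ^ (n + c) = N ^ c * N ^ n by rw [add_comm, pow_add], Module.End.mul_apply,
          map_sub (N ^ n), h1, sub_self, map_zero]
        exact Submodule.zero_mem _
    simpa using S.add_mem h3 (hS n w h2)

end Quadratic

/-! ### Degenerations to the origin -/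

section Degeneration

variable {k V : Type*} [Field k] [AddCommGroup V] [Module k V]
variable {ρ : Representation k (Ga k) V} {N : Module.End k V} {p : Module.Dual k V → V → k[X]}

/-- A map `k → V` with polynomial coordinates. -/
def IsPolyCurve (A : k → V) : Prop :=
  ∀ φ : Module.Dual k V, ∃ q : k[X], ∀ s, q.eval s = φ (A s)

lemma IsPolyCurve.add {A B : k → V} (hA : IsPolyCurve A) (hB : IsPolyCurve B) :
    IsPolyCurve fun s => A s + B s := fun φ => by
  obtain ⟨q, hq⟩ := hA φ
  obtain ⟨r, hr⟩ := hB φ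
  exact ⟨q + r, fun s => by simp [hq, hr]⟩

lemma isPolyCurve_eval (Q : k[X][X]) (L : k[X] →ₗ[k] V) :
    IsPolyCurve fun s => L (Q.eval (C s)) := fun φ => by
  refine ⟨Q.sum fun n a => monomial n (φ (L a)), fun s => ?_⟩
  change _ = φ (L (eval (C s) Q))
  rw [sum_def, eval_finsetSum, eval_eq_sum, sum_def, map_sum, map_sum]
  refine Finset.sum_congr rfl fun n _ => ?_
  rw [eval_monomial, ← C_pow, mul_comm (Q.coeff n), ← smul_eq_C_mul, map_smul, map_smul,
    smul_eq_mul, mul_comm]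

lemma IsPolyCurve.exists_eval_eq {A : k → V} (hA : IsPolyCurve A) {f : V → k}
    (hf : f ∈ polyFun k V) : ∃ q : k[X], ∀ s, q.eval s = f (A s) := by
  choose q hq using hA
  obtain ⟨P, rfl⟩ := hf
  refine ⟨MvPolynomial.aeval q P, fun s => ?_⟩
  have h1 := MvPolynomial.comp_aeval_apply q (aeval (R := k) s) P
  have h2 := MvPolynomial.comp_aeval_apply (fun φ : Module.Dual k V => (φ : V → k))
    (Pi.evalAlgHom k (fun _ : V => k) (A s)) P
  simp only [coe_aeval_eq_eval, Pi.evalAlgHom_apply, hq] at h1 h2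
  rw [h1]
  exact h2.symm

/-- The vectors `v` for which there are polynomial curves `A` through `v` and `B` through `0` (both
at `s = 0`) such that `B(s) = ρ(s⁻¹) A(s)` for `s ≠ 0`. -/
def degenerate (ρ : Representation k (Ga k) V) : AddSubmonoid V where
  carrier := {v | ∃ A B : k → V, IsPolyCurve A ∧ IsPolyCurve B ∧ A 0 = v ∧ B 0 = 0 ∧
    ∀ s ≠ 0, B s = ρ (Multiplicative.ofAdd s⁻¹) (A s)}
  zero_mem' := ⟨0, 0, fun _ => ⟨0, by simp⟩, fun _ => ⟨0, by simp⟩, rfl, rfl, by simp⟩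
  add_mem' := by
    rintro _ _ ⟨A, B, hA, hB, rfl, hB0, h⟩ ⟨A', B', hA', hB', rfl, hB0', h'⟩
    refine ⟨_, _, hA.add hA', hB.add hB', rfl, by simp [hB0, hB0'], fun s hs => ?_⟩
    rw [map_add, h s hs, h' s hs]

lemma degenerate_subset_nullcone [CharZero k] (ρ : Representation k (Ga k) V) :
    (degenerate ρ : Set V) ⊆ nullcone ρ := by
  rintro _ ⟨A, B, hA, hB, rfl, hB0, h⟩ f ⟨⟨hf, hinv⟩, hf0⟩
  obtain ⟨q, hq⟩ := hA.exists_eval_eq hf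
  obtain ⟨r, hr⟩ := hB.exists_eval_eq hf
  have hqr : q = r := by
    refine Polynomial.eq_of_infinite_eval_eq q r
      (Set.Infinite.mono ?_ (Set.finite_singleton (0 : k)).infinite_compl)
    intro s hs
    change q.eval s = r.eval s
    rw [hq, hr, h s hs, ← hinv (Multiplicative.ofAdd s⁻¹)⁻¹, inv_inv]
  rw [← hq, hqr, hr, hB0, hf0]

/-- The linear map `k[X] → V` with `Xⁱ ↦ i! Nᵈ⁻ⁱ w`. On polynomials of degree at most `d` it
intertwines differentiation with `N`, if `Nᵈ⁺¹ w = 0`. -/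
noncomputable def fromPoly (N : Module.End k V) (d : ℕ) (w : V) : k[X] →ₗ[k] V :=
  Polynomial.lsum fun i => LinearMap.toSpanSingleton k V ((i.factorial : k) • (N ^ (d - i)) w)

lemma fromPoly_monomial (N : Module.End k V) (d : ℕ) (w : V) (i : ℕ) (a : k) :
    fromPoly N d w (monomial i a) = (a * i.factorial) • (N ^ (d - i)) w := by
  simp [fromPoly, Polynomial.lsum_apply, sum_monomial_index, mul_smul]

/-- On polynomials of degree at most `d`, the action of `t` is the translation `X ↦ X + t`. -/
lemma IsGenerator.apply_fromPoly [CharZero k] (h : IsGenerator ρ N p) {d : ℕ} {w : V}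
    (hw : (N ^ (d + 1)) w = 0) (t : k) {P : k[X]} (hP : P.natDegree ≤ d) :
    ρ (Multiplicative.ofAdd t) (fromPoly N d w P) = fromPoly N d w (taylor t P) := by
  rw [P.as_sum_range' (d + 1) (Nat.lt_succ_of_le hP)]
  simp only [map_sum]
  refine Finset.sum_congr rfl fun i hi => ?_
  have hid : i ≤ d := Nat.lt_succ_iff.1 (Finset.mem_range.1 hi)
  have h0 : (N ^ (i + 1)) ((N ^ (d - i)) w) = 0 := by
    rw [← Module.End.mul_apply, ← pow_add, show i + 1 + (d - i) = d + 1 by omega, hw]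
  have h1 : taylor t (monomial i (P.coeff i)) = ∑ n ∈ Finset.range (i + 1),
      monomial (i - n) (P.coeff i * t ^ n * (i.choose n : k)) := by
    rw [taylor_monomial, add_comm, add_pow, Finset.mul_sum]
    refine Finset.sum_congr rfl fun n _ => ?_
    rw [← C_mul_X_pow_eq_monomial]
    simp only [C_mul, C_pow, C_eq_natCast]
    ring
  rw [h1, map_sum, fromPoly_monomial, map_smul, h.apply_eq_sum h0, Finset.smul_sum]
  refine Finset.sum_congr rfl fun n hn => ?_
  have hni : n ≤ i := Nat.lt_succ_iff.1 (Finset.mem_range.1 hn)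
  rw [fromPoly_monomial, smul_smul, ← Module.End.mul_apply, ← pow_add,
    show n + (d - i) = d - (i - n) by omega]
  congr 1
  have h2 : (i.factorial : k) = i.choose n * n.factorial * (i - n).factorial := by
    exact_mod_cast (Nat.choose_mul_factorial_mul_factorial hni).symm
  have h3 : (n.factorial : k) ≠ 0 := Nat.cast_ne_zero.2 n.factorial_ne_zero
  rw [h2]
  field_simp

lemma IsGenerator.pow_apply_mem_degenerate [CharZero k] (h : IsGenerator ρ N p) (j : ℕ) (w : V)
    (hw : (N ^ (2 * j + 2)) w = 0) : (N ^ (j + 1)) w ∈ degenerate ρ := by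
  set L : k[X] →ₗ[k] V := (j.factorial : k)⁻¹ • fromPoly N (2 * j + 1) w
  have hj : (j.factorial : k) ≠ 0 := Nat.cast_ne_zero.2 j.factorial_ne_zero
  -- `X` and `C X` are the outer and the inner variable: `A(s)` corresponds to the polynomial
  -- `Xʲ(1 - sX)ʲ⁺¹`, and `B(s)` to its translate by `s⁻¹`, which is `s(sX + 1)ʲ(-X)ʲ⁺¹`.
  refine ⟨_, _, isPolyCurve_eval (k := k) (C X ^ j * (1 - X * C X) ^ (j + 1)) L,
    isPolyCurve_eval (k := k) (X * (X * C X + 1) ^ j * C (-X) ^ (j + 1)) L, ?_, by simp, fun s hs => ?_⟩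
  · have h1 : L (X ^ j) = (N ^ (j + 1)) w := by
      rw [← monomial_one_right_eq_X_pow, LinearMap.smul_apply, fromPoly_monomial, one_mul,
        smul_smul, inv_mul_cancel₀ hj, one_smul]
      congr 2
      omega
    simpa using h1
  · have hdeg : (X ^ j * (1 - C s * X) ^ (j + 1) : k[X]).natDegree ≤ 2 * j + 1 := by
      compute_degree
      omega
    have ht : taylor s⁻¹ (X ^ j * (1 - C s * X) ^ (j + 1)) =
        C s * (C s * X + 1) ^ j * (-X) ^ (j + 1) := by
      have hc : C s * C s⁻¹ = (1 : k[X]) := by rw [← C_mul, mul_inv_cancel₀ hs, C_1]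
      have h2 : 1 - C s * (X + C s⁻¹) = C s * (-X) := by linear_combination -hc
      have h3 : C s * X + 1 = C s * (X + C s⁻¹) := by linear_combination -hc
      simp only [taylor_apply, mul_comp, pow_comp, sub_comp, X_comp, one_comp, C_comp]
      rw [h2, h3, mul_pow, mul_pow]
      ring
    simp only [L, eval_mul, eval_pow, eval_C, eval_sub, eval_one, eval_X, eval_add,
      LinearMap.smul_apply, map_smul]
    rw [h.apply_fromPoly hw _ hdeg, ht]

lemma zeroLocus_invariantsLE_two_eq_nullcone [CharZero k] [FiniteDimensional k V]
    (hρ : IsRationalRep (gaRegular k) ρ) :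
    zeroLocus (positivePart (invariantsLE ρ 2)) = nullcone ρ := by
  obtain ⟨N, p, h⟩ := exists_isGenerator hρ
  refine Set.Subset.antisymm (fun v hv => degenerate_subset_nullcone ρ ?_)
    fun v hv f hf => hv f ⟨hf.1.1, hf.2⟩
  obtain ⟨n, hn⟩ := h.exists_pow_apply_eq_zero v
  exact induction_of_pow_apply_mem_range N _ h.pow_apply_mem_degenerate n v hn
    (h.pow_apply_mem_range hv)

end Degeneration

/-! ### Degree one does not suffice -/

section LowerBound

variable {k : Type*} [Field k]

/-- The translation action `p(X) ↦ p(X + t)` on polynomials `a + bX + cX²`, identified with the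
triples `(a, b, c)`. -/
def quadRep (k : Type*) [Field k] : Representation k (Ga k) (k × k × k) where
  toFun g :=
    { toFun := fun v => (v.1 + g.toAdd * v.2.1 + g.toAdd ^ 2 * v.2.2,
        v.2.1 + 2 * g.toAdd * v.2.2, v.2.2)
      map_add' := fun v w => by ext <;> simp <;> ring
      map_smul' := fun c v => by ext <;> simp <;> ring }
  map_one' := by
    ext <;> simp
  map_mul' g h := by
    refine LinearMap.ext fun v => ?_
    ext <;> simp <;> ring

lemma quadRep_apply (g : Ga k) (v : k × k × k) :
    quadRep k g v = (v.1 + g.toAdd * v.2.1 + g.toAdd ^ 2 * v.2.2,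
      v.2.1 + 2 * g.toAdd * v.2.2, v.2.2) := rfl

lemma isRationalRep_quadRep : IsRationalRep (gaRegular k) (quadRep k) := by
  intro v φ
  refine ⟨C (φ (1, 0, 0)) * (C v.1 + X * C v.2.1 + X ^ 2 * C v.2.2) +
    C (φ (0, 1, 0)) * (C v.2.1 + 2 * X * C v.2.2) + C (φ (0, 0, 1)) * C v.2.2, ?_⟩
  ext g
  have h1 : quadRep k g v = (v.1 + g.toAdd * v.2.1 + g.toAdd ^ 2 * v.2.2) • ((1, 0, 0) : k × k × k)
      + (v.2.1 + 2 * g.toAdd * v.2.2) • ((0, 1, 0) : k × k × k)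
      + v.2.2 • ((0, 0, 1) : k × k × k) := by
    rw [quadRep_apply]
    ext <;> simp
  rw [h1]
  change aeval (fun t : Ga k => Multiplicative.toAdd t) _ g = _
  simp only [map_add, map_mul, map_pow, aeval_X, aeval_C, map_ofNat, map_smul, Pi.add_apply,
    Pi.mul_apply, Pi.pow_apply, Pi.algebraMap_apply, Algebra.algebraMap_self, RingHom.id_apply,
    smul_eq_mul, Pi.ofNat_apply]
  ring

lemma discrim_mem_invariants :
    (fun v : k × k × k => v.2.1 * v.2.1 - 4 * (v.1 * v.2.2)) ∈ invariants (quadRep k) := by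
  refine ⟨?_, fun g v => ?_⟩
  · let x : Module.Dual k (k × k × k) := LinearMap.fst k k (k × k)
    let y : Module.Dual k (k × k × k) := LinearMap.fst k k k ∘ₗ LinearMap.snd k k (k × k)
    let z : Module.Dual k (k × k × k) := LinearMap.snd k k k ∘ₗ LinearMap.snd k k (k × k)
    refine ⟨MvPolynomial.X y * MvPolynomial.X y -
      4 * (MvPolynomial.X x * MvPolynomial.X z), ?_⟩
    ext v
    change MvPolynomial.aeval (fun φ : Module.Dual k (k × k × k) => (φ : k × k × k → k)) _ v = _
    simp only [x, y, z, map_sub, map_mul, map_ofNat, MvPolynomial.aeval_X]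
    rfl
  · simp only [quadRep_apply]
    ring

lemma add_apply_of_mem_polyFunLE_one {V : Type*} [AddCommGroup V] [Module k V] {f : V → k}
    (hf : f ∈ polyFunLE k V 1) (x y : V) : f (x + y) + f 0 = f x + f y := by
  obtain ⟨P, hP, rfl⟩ := hf
  rw [SetLike.mem_coe, MvPolynomial.mem_restrictTotalDegree] at hP
  have h1 : ∀ v, (polyToFun k V).toLinearMap P v =
      ∑ d ∈ P.support, P.coeff d * ∏ φ ∈ d.support, φ v ^ d φ := by
    intro v
    have h2 := MvPolynomial.comp_aeval_apply (fun φ : Module.Dual k V => (φ : V → k))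
      (Pi.evalAlgHom k (fun _ : V => k) v) P
    refine h2.trans ?_
    rw [MvPolynomial.aeval_eq_eval]
    exact MvPolynomial.eval_eq _ _
  simp only [h1, ← Finset.sum_add_distrib, ← mul_add]
  refine Finset.sum_congr rfl fun d hd => ?_
  congr 1
  have h3 : d.sum (fun _ e => e) ≤ 1 := (MvPolynomial.le_totalDegree hd).trans hP
  rcases Nat.le_one_iff_eq_zero_or_eq_one.1 h3 with h4 | h4
  · have : d = 0 := by
      rwa [← Finsupp.degree_eq_zero_iff]
    simp [this]
  · obtain ⟨φ, rfl⟩ : ∃ φ, d = Finsupp.single φ 1 := by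
      exact (Finsupp.sum_eq_one_iff d).1 h4
    simp

/-- A linear invariant vanishes at every difference `p(X + 1) - p(X)`, hence at
`2X = ((X + 1)² - X²) - ((X + 1) - X)`, but the discriminant of `2X` is `4`. -/
lemma two_le_sigmaRep_quadRep [CharZero k] : 2 ≤ sigmaRep (quadRep k) := by
  refine le_iInf₂ fun d hd => ?_
  by_contra hlt
  have hd1 : d ≤ 1 := by
    have : d < 2 := by exact_mod_cast not_le.1 hlt
    omega
  have hv : ((0, 2, 0) : k × k × k) ∉ nullcone (quadRep k) := by
    intro hn
    have := hn _ ⟨discrim_mem_invariants, by simp⟩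
    norm_num at this
  obtain ⟨f, ⟨⟨⟨-, hinv⟩, hdeg⟩, hf0⟩, hne⟩ := hd.2 _ hv
  refine hne ?_
  have hadd : ∀ x y, f (x + y) = f x + f y := fun x y => by
    simpa [hf0] using add_apply_of_mem_polyFunLE_one (polyFunLE_mono hd1 hdeg) x y
  have h1 := hinv (Multiplicative.ofAdd 1)⁻¹ (0, 1, 0)
  have h2 := hinv (Multiplicative.ofAdd 1)⁻¹ (0, 0, 1)
  simp only [inv_inv, quadRep_apply, toAdd_ofAdd] at h1 h2
  have e1 : ((0 + 1 * 1 + 1 ^ 2 * 0, 1 + 2 * 1 * 0, 0) : k × k × k) = (1, 0, 0) + (0, 1, 0) := by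
    ext <;> simp
  have e2 : ((0 + 1 * 0 + 1 ^ 2 * 1, 0 + 2 * 1 * 1, 1) : k × k × k) =
      (1, 0, 0) + (0, 2, 0) + (0, 0, 1) := by
    ext <;> simp
  rw [e1, hadd] at h1
  rw [e2, hadd, hadd] at h2
  linear_combination h2 - h1

end LowerBound

end ZeroSeparation

theorem mainTheorem8 (k : Type*) [Field k] [CharZero k] :
    ZeroSeparation.sigma (ZeroSeparation.gaRegular k) = 2 ∧
    ∀ (V : Type*) [AddCommGroup V] [Module k V] [FiniteDimensional k V]
      (ρ : Representation k (ZeroSeparation.Ga k) V),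
      ZeroSeparation.IsRationalRep (ZeroSeparation.gaRegular k) ρ →
      ZeroSeparation.zeroLocus
          (ZeroSeparation.positivePart (ZeroSeparation.invariantsLE ρ 2)) =
        ZeroSeparation.nullcone ρ := by
  refine ⟨le_antisymm (sSup_le ?_) ?_, fun V _ _ _ ρ hρ =>
    ZeroSeparation.zeroLocus_invariantsLE_two_eq_nullcone hρ⟩
  · rintro _ ⟨V, _, _, _, ρ, hρ, rfl⟩
    refine iInf₂_le 2 ⟨fun f hf => hf.1, fun v hv => ?_⟩
    rw [← ZeroSeparation.zeroLocus_invariantsLE_two_eq_nullcone hρ] at hv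
    simpa [ZeroSeparation.zeroLocus] using hv
  · exact ZeroSeparation.two_le_sigmaRep_quadRep.trans
      (le_sSup ⟨k × k × k, _, _, inferInstance, _, ZeroSeparation.isRationalRep_quadRep, rfl⟩)
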